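/- \textbf{Theorem (Equivalence of model-based and data-driven UIO conditions).} Consider the discrete-time descriptor system $$Ex(k+1)=Ax(k)+Bu(k)+F\eta(k),\qquad y(k)=Cx(k),\qquad k\in\mathbb Z_0=\{0,1,2,\dots\},$$ with $E,A\in\mathbb R^{n\times n}$, $B\in\mathbb R^{n\times m}$, $F\in\mathbb R^{n\times q}$, $C\in\mathbb R^{p\times n}$, known input $u$ and unknown input $\eta$, and suppose it is regular: $\det(\lambda E-A)\neq0$ for some $\lambda\in\mathbb C$. Let $S,P\in\mathbb R^{n\times n}$ be invertible with $$SEP=\begin{bmatrix}I_{n_1}&0\\0&R\end{bmatrix},\qquad SAP=\begin{bmatrix}A_1&0\\0&I_{n_2}\end{bmatrix},\qquad n_1+n_2=n,$$ where $R$ is nilpotent of index $s$, i.e. $s$ is the least nonnegative integer with $R^s=0$ ($s=0$ if $n_2=0$). For a state $x$ let $z_1\in\mathbb R^{n_1}$ consist of the first $n_1$ entries of $P^{-1}x$. Let $u_d(0),\dots,u_d(T+s-1)$, $x_d(0),\dots,x_d(T)$, $y_d(0),\dots,y_d(T)$ be data sampled from a trajectory of the system with unknown input values $\eta_d(0),\dots,\eta_d(T+s-1)$.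 Put $U_p=[u_d(0),\dots,u_d(T-1)]$, $X_p=[x_d(0),\dots,x_d(T-1)]$, $X_f=[x_d(1),\dots,x_d(T)]$, $Y_p=[y_d(0),\dots,y_d(T-1)]$, $Y_f=[y_d(1),\dots,y_d(T)]$, let $z_{1d}(k)$ be the $z_1$-component of $x_d(k)$, and for samples $f(0),\dots,f(T+L-2)$ let $H_L(f)$ be the Hankel matrix with $L$ block rows and $T$ columns whose $(i,j)$ block is $f(i+j)$, $0\le i\le L-1$, $0\le j\le T-1$. Assume (a) (rich data) $\operatorname{rk}\begin{bmatrix}H_1(z_{1d})\\H_{s+1}(u_d)\\H_{s+1}(\eta_d)\end{bmatrix}=n_1+(m+q)(s+1)$, i.e. this matrix (with $T$ columns) has full row rank; (b) (matching condition) $\operatorname{rk}\begin{bmatrix}E&F\\C&0\end{bmatrix}=n+q$. Then $$\operatorname{Ker}(X_f)\supseteq\operatorname{Ker}\begin{bmatrix}X_p\\U_p\\Y_p\\Y_f\end{bmatrix},$$ and the following statements are equivalent: (i) There exists a full-order unknown input observer (UIO), i.e. there are real matrices $A_O,B_O^u,B_O^y,N_O$ such that, for every trajectory $(u,\eta,x,y)$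 of the system on $\mathbb Z_0$ and every initial estimate $\hat x(0)\in\mathbb R^n$, the sequence $$\hat x(k+1)=A_O\hat x(k)+B_O^uu(k)+B_O^yy(k)+N_Oy(k+1)$$ satisfies $\lim_{k\to\infty}\|x(k)-\hat x(k)\|=0$. (ii) There exist real matrices $\bar\Sigma_{X_p},\bar\Sigma_{U_p},\bar\Sigma_{Y_p},\bar\Sigma_{Y_f}$ such that $$X_f=\begin{bmatrix}\bar\Sigma_{X_p}&\bar\Sigma_{U_p}&\bar\Sigma_{Y_p}&\bar\Sigma_{Y_f}\end{bmatrix}\begin{bmatrix}X_p\\U_p\\Y_p\\Y_f\end{bmatrix}$$ and $\bar\Sigma_{X_p}$ is Schur stable (all its eigenvalues have modulus $<1$). (iii) $\operatorname{rk}\begin{bmatrix}\lambda X_p-X_f\\U_p\\Y_p\\Y_f\end{bmatrix}=\operatorname{rk}\begin{bmatrix}X_p\\U_p\\Y_f\end{bmatrix}$ for all $\lambda\in\mathbb C$ with $|\lambda|\ge1$. (iv) $\operatorname{rk}\begin{bmatrix}\lambda E-A&-F\\C&0\end{bmatrix}=n+q$ for all $\lambda\in\mathbb C$ with $|\lambda|\ge1$.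 -/

import Mathlib

open Matrix Filter Topology

namespace Descriptor

/-- Matrices of the discrete-time descriptor system with known input `u` and unknown input `η`:
`E x(k+1) = A x(k) + B u(k) + F η(k)`, `y(k) = C x(k)`. -/
structure DescriptorSystem (n m p q : ℕ) where
  E : Matrix (Fin n) (Fin n) ℝ
  A : Matrix (Fin n) (Fin n) ℝ
  B : Matrix (Fin n) (Fin m) ℝ
  F : Matrix (Fin n) (Fin q) ℝ
  C : Matrix (Fin p) (Fin n) ℝ

/-- The entrywise embedding of a real matrix into the complex matrices. -/
abbrev toComplex {ι κ : Type*} (M : Matrix ι κ ℝ) : Matrix ι κ ℂ := M.map (fun a => (a : ℂ))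

/-- A real square matrix is Schur stable: all its complex eigenvalues lie in the open unit disc. -/
def IsSchurStable {n : ℕ} (M : Matrix (Fin n) (Fin n) ℝ) : Prop :=
  ∀ μ ∈ spectrum ℂ (toComplex M), ‖μ‖ < 1

/-- The matrix `[M₁; M₂; M₃]`. -/
abbrev col3 {ι₁ ι₂ ι₃ κ R : Type*} (M₁ : Matrix ι₁ κ R) (M₂ : Matrix ι₂ κ R)
    (M₃ : Matrix ι₃ κ R) : Matrix (ι₁ ⊕ ι₂ ⊕ ι₃) κ R :=
  fromRows M₁ (fromRows M₂ M₃)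

/-- The matrix `[M₁; M₂; M₃; M₄]`. -/
abbrev col4 {ι₁ ι₂ ι₃ ι₄ κ R : Type*} (M₁ : Matrix ι₁ κ R) (M₂ : Matrix ι₂ κ R)
    (M₃ : Matrix ι₃ κ R) (M₄ : Matrix ι₄ κ R) : Matrix (ι₁ ⊕ ι₂ ⊕ ι₃ ⊕ ι₄) κ R :=
  fromRows M₁ (fromRows M₂ (fromRows M₃ M₄))

/-- The matrix `[M₁, M₂, M₃, M₄]`. -/
abbrev row4 {ι κ₁ κ₂ κ₃ κ₄ R : Type*} (M₁ : Matrix ι κ₁ R) (M₂ : Matrix ι κ₂ R)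
    (M₃ : Matrix ι κ₃ R) (M₄ : Matrix ι κ₄ R) : Matrix ι (κ₁ ⊕ κ₂ ⊕ κ₃ ⊕ κ₄) R :=
  fromCols M₁ (fromCols M₂ (fromCols M₃ M₄))

namespace DescriptorSystem

variable {n m p q : ℕ}

/-- `(u, η, x, y)` is a trajectory of the system on `k = 0, 1, 2, …`. -/
def IsTrajectory (sys : DescriptorSystem n m p q) (u : ℕ → Fin m → ℝ) (η : ℕ → Fin q → ℝ)
    (x : ℕ → Fin n → ℝ) (y : ℕ → Fin p → ℝ) : Prop :=
  ∀ k, sys.E *ᵥ x (k + 1) = sys.A *ᵥ x k + sys.B *ᵥ u k + sys.F *ᵥ η k ∧ y k = sys.C *ᵥ x k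

/-- Regularity: `det (λE - A) ≠ 0` for some complex `λ`. -/
def IsRegular (sys : DescriptorSystem n m p q) : Prop :=
  ∃ lam : ℂ, (lam • toComplex sys.E - toComplex sys.A).det ≠ 0

/-- The observer `x̂(k+1) = A_O x̂(k) + B_O^u u(k) + B_O^y y(k) + N_O y(k+1)` is a full-order
unknown input observer: the error tends to zero for every trajectory of the system (thus for every
consistent initial state, every known and every unknown input) and every initial estimate. -/
def IsUnknownInputObserver (sys : DescriptorSystem n m p q)
    (AO : Matrix (Fin n) (Fin n) ℝ) (BOu : Matrix (Fin n) (Fin m) ℝ)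
    (BOy : Matrix (Fin n) (Fin p) ℝ) (NO : Matrix (Fin n) (Fin p) ℝ) : Prop :=
  ∀ (u : ℕ → Fin m → ℝ) (η : ℕ → Fin q → ℝ) (x : ℕ → Fin n → ℝ) (y : ℕ → Fin p → ℝ)
    (xhat : ℕ → Fin n → ℝ),
    sys.IsTrajectory u η x y →
    (∀ k, xhat (k + 1) = AO *ᵥ xhat k + BOu *ᵥ u k + BOy *ᵥ y k + NO *ᵥ y (k + 1)) →
    Tendsto (fun k => ‖WithLp.toLp 2 (x k - xhat k)‖) atTop (𝓝 0)

/-- A decomposition of the pencil into slow and fast parts: invertible `S`, `P` with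
`S E P = diag(I, R)`, `S A P = diag(A₁, I)`, where `R` is nilpotent of index exactly `s`
(so `s = 0` precisely when the fast part is empty). The slow block consists of the first `n₁`
coordinates, the fast block of the last `n₂`. -/
structure Decomposition (sys : DescriptorSystem n m p q) (n₁ n₂ s : ℕ) where
  dim_eq : n₁ + n₂ = n
  S : Matrix (Fin n) (Fin n) ℝ
  P : Matrix (Fin n) (Fin n) ℝ
  A₁ : Matrix (Fin n₁) (Fin n₁) ℝ
  R : Matrix (Fin n₂) (Fin n₂) ℝ
  isUnit_S : IsUnit S
  isUnit_P : IsUnit P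
  decomp_E : S * sys.E * P =
    (fromBlocks 1 0 0 R).reindex (finSumFinEquiv.trans (finCongr dim_eq))
      (finSumFinEquiv.trans (finCongr dim_eq))
  decomp_A : S * sys.A * P =
    (fromBlocks A₁ 0 0 1).reindex (finSumFinEquiv.trans (finCongr dim_eq))
      (finSumFinEquiv.trans (finCongr dim_eq))
  nilpotent : R ^ s = 0
  index_minimal : ∀ j < s, R ^ j ≠ 0

/-- The slow component `z₁` of `z = P⁻¹ x`. -/
noncomputable def Decomposition.slowState {sys : DescriptorSystem n m p q} {n₁ n₂ s : ℕ}
    (D : sys.Decomposition n₁ n₂ s) (x : Fin n → ℝ) : Fin n₁ → ℝ :=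
  fun i => (D.P⁻¹ *ᵥ x) (finCongr D.dim_eq (Fin.castAdd n₂ i))

end DescriptorSystem

/-- The Hankel matrix of depth `s + 1` of a sequence of `T + s` samples: it has `T` columns, and
its `(i, j)` block is `f (i + j)`. -/
def hankel {T : ℕ} {ι : Type*} (s : ℕ) (f : Fin (T + s) → ι → ℝ) :
    Matrix (Fin (s + 1) × ι) (Fin T) ℝ :=
  Matrix.of fun i j => f ⟨j.1 + i.1.1, by omega⟩ i.2

/-- Historical data: inputs `u_d(0), …, u_d(T+s-1)`, outputs `y_d(0), …, y_d(T)` and states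
`x_d(0), …, x_d(T)`. -/
structure Data (n m p T s : ℕ) where
  ud : Fin (T + s) → Fin m → ℝ
  yd : Fin (T + 1) → Fin p → ℝ
  xd : Fin (T + 1) → Fin n → ℝ

namespace Data

variable {n m p q T s : ℕ}

/-- `[u_d(0), …, u_d(T-1)]` -/
def Up (d : Data n m p T s) : Matrix (Fin m) (Fin T) ℝ :=
  Matrix.of fun i j => d.ud (Fin.castAdd s j) i

/-- `[y_d(0), …, y_d(T-1)]` -/
def Yp (d : Data n m p T s) : Matrix (Fin p) (Fin T) ℝ := Matrix.of fun i j => d.yd j.castSucc i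

/-- `[y_d(1), …, y_d(T)]` -/
def Yf (d : Data n m p T s) : Matrix (Fin p) (Fin T) ℝ := Matrix.of fun i j => d.yd j.succ i

/-- `[x_d(0), …, x_d(T-1)]` -/
def Xp (d : Data n m p T s) : Matrix (Fin n) (Fin T) ℝ := Matrix.of fun i j => d.xd j.castSucc i

/-- `[x_d(1), …, x_d(T)]` -/
def Xf (d : Data n m p T s) : Matrix (Fin n) (Fin T) ℝ := Matrix.of fun i j => d.xd j.succ i

/-- The data are collected from the system while the unknown input takes the values `ηd`: they are
samples of a trajectory of the system. -/
def CollectedFrom (d : Data n m p T s) (sys : DescriptorSystem n m p q)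
    (ηd : Fin (T + s) → Fin q → ℝ) : Prop :=
  ∃ (u : ℕ → Fin m → ℝ) (η : ℕ → Fin q → ℝ) (x : ℕ → Fin n → ℝ) (y : ℕ → Fin p → ℝ),
    sys.IsTrajectory u η x y ∧
    (∀ k : Fin (T + s), d.ud k = u k ∧ ηd k = η k) ∧
    (∀ k : Fin (T + 1), d.xd k = x k ∧ d.yd k = y k)

/-- The data are rich enough: the matrix `[H₁(z₁d); H_{s+1}(u_d); H_{s+1}(η_d)]` has full row rank
`n₁ + (m + q)(s + 1)`. -/
def IsInformative (d : Data n m p T s) (ηd : Fin (T + s) → Fin q → ℝ)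
    {sys : DescriptorSystem n m p q} {n₁ n₂ : ℕ} (D : sys.Decomposition n₁ n₂ s) : Prop :=
  (col3 (hankel 0 fun k : Fin T => D.slowState (d.xd k.castSucc))
    (hankel s d.ud) (hankel s ηd)).rank = n₁ + (m + q) * (s + 1)

end Data

end Descriptor

/-! All four statements come down to one modal condition: if `λEw = Aw + Fv`, `Cw = 0` and `|λ| ≥
1`, then `w = 0`. By the matching condition this gives (iv), since `v` is then zero too
(`rank_pencil_eq`). The implications proved are (i) ↔ (iv) and (iv) → (ii) → (iii) → (iv).

From (i): a modal pair yields trajectories, the real and imaginary parts of `λᵏw`, with zero known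
input and output. The zero estimate is compatible with them, so they must decay, which forces `w =
0` (`eq_zero_of_observer`).

From (iv): the solutions of `W₁E + W₂C = 1`, `W₁F = 0` obtained from a left inverse of the matching
matrix leave a free parameter. Condition (iv) is detectability of the resulting pair, so some choice
makes `W₁A - GC` Schur stable (`exists_isSchurStable_of_rank`). The same matrices give both the
observer and the data representation (ii). Stabilization itself moves unstable eigenvalues to the
origin by real rank-one output injections (`exists_isSchurStable_sub_mul`).

With data: (ii) → (iii) compares kernels, and (iii) → (iv) uses that rich data reproduce the first
two states of every trajectory (`exists_coeff`), hence every modal pair. -/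

namespace Descriptor

/-! ### Ranks, kernels and a rank-one determinant formula. -/

section LinearAlgebra

theorem toMatrix'_mulVecLin {ι κ K : Type*} [CommSemiring K] [Fintype κ] [DecidableEq κ]
    (M : Matrix ι κ K) : LinearMap.toMatrix' M.mulVecLin = M :=
  LinearMap.toMatrix'_toLin' M

theorem rank_eq_card_iff {ι κ K : Type*} [Field K] [Fintype κ]
    (M : Matrix ι κ K) : M.rank = Fintype.card κ ↔ ∀ v, M *ᵥ v = 0 → v = 0 := by
  have h := LinearMap.finrank_range_add_finrank_ker M.mulVecLin
  rw [Module.finrank_fintype_fun_eq_card] at h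
  have h2 : (LinearMap.ker M.mulVecLin = ⊥) ↔ ∀ v, M *ᵥ v = 0 → v = 0 := by
    rw [LinearMap.ker_eq_bot']; rfl
  rw [← h2, ← Submodule.finrank_eq_zero (R := K), Matrix.rank]
  omega

theorem exists_left_inverse_of_rank_eq {ι κ K : Type*} [Field K] [Fintype ι] [Fintype κ]
    [DecidableEq ι] [DecidableEq κ] (M : Matrix ι κ K) (h : M.rank = Fintype.card κ) :
    ∃ L : Matrix κ ι K, L * M = 1 := by
  rw [rank_eq_card_iff] at h
  obtain ⟨g, hg⟩ := LinearMap.exists_leftInverse_of_injective M.mulVecLin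
    (LinearMap.ker_eq_bot'.2 h)
  refine ⟨LinearMap.toMatrix' g, ?_⟩
  rw [← toMatrix'_mulVecLin M, ← LinearMap.toMatrix'_comp, hg, LinearMap.toMatrix'_id]

theorem exists_right_inverse_of_rank_eq {ι κ K : Type*} [Field K] [Fintype ι] [Fintype κ]
    [DecidableEq ι] [DecidableEq κ] (M : Matrix ι κ K) (h : M.rank = Fintype.card ι) :
    ∃ L : Matrix κ ι K, M * L = 1 := by
  rw [← rank_transpose] at h
  obtain ⟨L, hL⟩ := exists_left_inverse_of_rank_eq _ h
  exact ⟨Lᵀ, by rw [← transpose_inj]; simpa using hL⟩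

theorem exists_rank_factorization {ι κ K : Type*} [Field K] [Fintype ι] [Fintype κ]
    [DecidableEq ι] [DecidableEq κ] (M : Matrix ι κ K) :
    ∃ (A : Matrix ι (Fin M.rank) K) (B : Matrix (Fin M.rank) κ K) (L : Matrix (Fin M.rank) ι K)
      (R : Matrix κ (Fin M.rank) K), M = A * B ∧ L * M * R = 1 := by
  let b : Module.Basis (Fin M.rank) K (LinearMap.range M.mulVecLin) := Module.finBasis K _
  let e := b.equivFun
  let f : (Fin M.rank → K) →ₗ[K] ι → K := (LinearMap.range M.mulVecLin).subtype ∘ₗ e.symm.toLinearMap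
  let g : (κ → K) →ₗ[K] (Fin M.rank → K) := e.toLinearMap ∘ₗ M.mulVecLin.rangeRestrict
  have hf : LinearMap.ker f = ⊥ := by
    rw [LinearMap.ker_eq_bot]
    exact (Submodule.injective_subtype _).comp e.symm.injective
  have hg : LinearMap.range g = ⊤ := by
    rw [LinearMap.range_eq_top]
    exact e.surjective.comp M.mulVecLin.surjective_rangeRestrict
  have hfg : f ∘ₗ g = M.mulVecLin := by ext; simp [f, g]
  obtain ⟨l, hl⟩ := LinearMap.exists_leftInverse_of_injective f hf
  obtain ⟨r, hr⟩ := LinearMap.exists_rightInverse_of_surjective g hg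
  refine ⟨LinearMap.toMatrix' f, LinearMap.toMatrix' g, LinearMap.toMatrix' l,
    LinearMap.toMatrix' r, ?_, ?_⟩
  · rw [← LinearMap.toMatrix'_comp, hfg, toMatrix'_mulVecLin]
  · have hM : LinearMap.toMatrix' l * LinearMap.toMatrix' (f ∘ₗ g) * LinearMap.toMatrix' r = 1 := by
      rw [← LinearMap.toMatrix'_comp, ← LinearMap.toMatrix'_comp, ← LinearMap.comp_assoc, hl,
        LinearMap.id_comp, hr, LinearMap.toMatrix'_id]
    rwa [hfg, toMatrix'_mulVecLin] at hM

/-- The identities `M = A * B` and `L * M * R = 1`, with inner size `M.rank`, survive a ring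
homomorphism; the first bounds the rank from above and the second from below. -/
theorem rank_map_ringHom {ι κ K F : Type*} [Field K] [Field F] [Fintype ι] [Fintype κ]
    (φ : K →+* F) (M : Matrix ι κ K) : (M.map φ).rank = M.rank := by
  classical
  obtain ⟨A, B, L, R, hM, hLR⟩ := exists_rank_factorization M
  refine le_antisymm ?_ ?_
  · have : M.map φ = A.map φ * B.map φ := by rw [← Matrix.map_mul, ← hM]
    rw [this]
    refine (rank_mul_le_left _ _).trans ((rank_le_card_width _).trans ?_)
    simp
  · have : L.map φ * M.map φ * R.map φ = 1 := by
      rw [← Matrix.map_mul, ← Matrix.map_mul, hLR]; simp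
    calc M.rank = (1 : Matrix (Fin M.rank) (Fin M.rank) F).rank := by simp
      _ ≤ _ := by rw [← this]; exact (rank_mul_le_left _ _).trans (rank_mul_le_right _ _)

theorem rank_eq_of_ker_eq {ι₁ ι₂ κ K : Type*} [Field K] [Fintype κ]
    {M : Matrix ι₁ κ K} {N : Matrix ι₂ κ K} (h : ∀ v, M *ᵥ v = 0 ↔ N *ᵥ v = 0) :
    M.rank = N.rank := by
  have h1 := LinearMap.finrank_range_add_finrank_ker M.mulVecLin
  have h2 := LinearMap.finrank_range_add_finrank_ker N.mulVecLin
  have : LinearMap.ker M.mulVecLin = LinearMap.ker N.mulVecLin := by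
    ext v; simpa using h v
  rw [this] at h1
  unfold Matrix.rank
  omega

theorem ker_le_of_rank_eq {ι₁ ι₂ κ K : Type*} [Field K] [Fintype κ]
    {M : Matrix ι₁ κ K} {N : Matrix ι₂ κ K} (h : ∀ v, N *ᵥ v = 0 → M *ᵥ v = 0)
    (hr : M.rank = N.rank) (v : κ → K) (hv : M *ᵥ v = 0) : N *ᵥ v = 0 := by
  have h1 := LinearMap.finrank_range_add_finrank_ker M.mulVecLin
  have h2 := LinearMap.finrank_range_add_finrank_ker N.mulVecLin
  have hle : LinearMap.ker N.mulVecLin ≤ LinearMap.ker M.mulVecLin := fun v hv => by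
    simpa using h v (by simpa using hv)
  unfold Matrix.rank at hr
  have := Submodule.eq_of_le_of_finrank_eq hle (by omega)
  have hv' : v ∈ LinearMap.ker N.mulVecLin := by rw [this]; simpa using hv
  simpa using hv'

/-- If `M v = D u` then the rank-one update `M + u rᵀ` multiplies the determinant by
`(D + rᵀ v) / D`. -/
theorem det_mul_eq_mul_det_add_vecMulVec {R ι : Type*} [CommRing R] [IsDomain R] [Fintype ι]
    [DecidableEq ι] (M : Matrix ι ι R) {D : R} (hD : D ≠ 0) (u v r : ι → R)
    (h : M *ᵥ v = D • u) :
    M.det * (D + v ⬝ᵥ r) = D * (M + vecMulVec u r).det := by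
  rcases isEmpty_or_nonempty ι with hι | hι
  · simp
  -- The determinant of `D·1 + v rᵀ` is a characteristic polynomial evaluated at `D`, so taking
  -- determinants here leaves a common power of `D` to cancel.
  have h1 : M * (scalar ι D - vecMulVec (-v) r) = D • (M + vecMulVec u r) := by
    rw [Matrix.mul_sub, mul_vecMulVec, mulVec_neg, h, ← neg_smul, smul_add]
    ext i j
    simp [vecMulVec_apply, mul_comm]
  have h2 := congrArg det h1
  rw [det_mul, ← eval_charpoly, charpoly_vecMulVec, det_smul] at h2
  obtain ⟨k, hk⟩ : ∃ k, Fintype.card ι = k + 1 := ⟨Fintype.card ι - 1, by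
    have := Fintype.card_pos (α := ι); omega⟩
  simp only [hk, Nat.add_sub_cancel, neg_dotProduct, neg_smul, sub_neg_eq_add, Polynomial.eval_add,
    Polynomial.eval_pow, Polynomial.eval_X, Polynomial.eval_smul, smul_eq_mul] at h2
  apply mul_left_cancel₀ (pow_ne_zero k hD)
  linear_combination h2

end LinearAlgebra

/-! ### Moving eigenvalues to the origin by rank-one updates. -/

section PoleShift

open Polynomial

variable {ι K : Type*} [Fintype ι] [DecidableEq ι] [Field K]

theorem charmatrix_sub_vecMulVec (A : Matrix ι ι K) (u r : ι → K) :
    (A - vecMulVec u r).charmatrix =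
      A.charmatrix + vecMulVec (fun i => C (u i)) (fun i => C (r i)) := by
  ext1 i j
  simp [charmatrix_apply, vecMulVec_apply]
  ring

theorem charmatrix_mulVec_C (A : Matrix ι ι K) {w : ι → K} {l : K} (hw : A *ᵥ w = l • w) :
    A.charmatrix *ᵥ (fun i => C (w i)) = (X - C l) • fun i => C (w i) := by
  have h : (A.map C) *ᵥ (fun i => C (w i)) = fun i => C l * C (w i) := by
    ext1 i
    have := congrFun hw i
    simp only [mulVec, dotProduct, Pi.smul_apply, smul_eq_mul] at this
    simp only [mulVec, dotProduct, map_apply, ← C_mul, ← map_sum, this]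
  have h2 : A.charmatrix = scalar ι (X : K[X]) - A.map C := rfl
  rw [h2, sub_mulVec, h]
  ext1 i
  simp [sub_mul]

theorem C_dotProduct_C {ι K : Type*} [Fintype ι] [Field K] (w r : ι → K) :
    (fun i => C (w i)) ⬝ᵥ (fun i => C (r i)) = C (w ⬝ᵥ r) := by
  simp [dotProduct]

/-- The determinant formula over `K[X]` with `D = X - l`: the normalization `w ⬝ᵥ r = l` turns `D +
w ⬝ᵥ r` into `X`, so one root `l` becomes `0`. -/
theorem charpoly_mul_X_eq (A : Matrix ι ι K) {w r : ι → K} {l : K} (hw : A *ᵥ w = l • w)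
    (hr : w ⬝ᵥ r = l) :
    A.charpoly * X = (X - C l) * (A - vecMulVec w r).charpoly := by
  have := det_mul_eq_mul_det_add_vecMulVec A.charmatrix (X_sub_C_ne_zero l) _ _
    (fun i => C (r i)) (charmatrix_mulVec_C A hw)
  rwa [C_dotProduct_C, hr, ← charmatrix_sub_vecMulVec, sub_add_cancel] at this

theorem charpoly_mul_X_sq_eq (A : Matrix ι ι K) {w₁ w₂ r : ι → K} {l₁ l₂ : K}
    (h₁ : A *ᵥ w₁ = l₁ • w₁) (h₂ : A *ᵥ w₂ = l₂ • w₂) (hl : l₁ ≠ l₂)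
    (hr₁ : w₁ ⬝ᵥ r ≠ 0) (hr₂ : w₂ ⬝ᵥ r ≠ 0) :
    A.charpoly * X ^ 2 = (X - C l₁) * (X - C l₂) *
      (A - vecMulVec ((l₁ ^ 2 / ((w₁ ⬝ᵥ r) * (l₁ - l₂))) • w₁ +
        (l₂ ^ 2 / ((w₂ ⬝ᵥ r) * (l₂ - l₁))) • w₂) r).charpoly := by
  set a := l₁ ^ 2 / ((w₁ ⬝ᵥ r) * (l₁ - l₂)) with ha
  set b := l₂ ^ 2 / ((w₂ ⬝ᵥ r) * (l₂ - l₁)) with hb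
  have hl' : l₂ - l₁ ≠ 0 := sub_ne_zero.2 hl.symm
  have hl'' : l₁ - l₂ ≠ 0 := sub_ne_zero.2 hl
  -- Here `D = (X - l₁)(X - l₂)`. The weights `a` and `b` are the solution of the two linear
  -- equations `e3` and `e4`, which say that `D + v ⬝ᵥ r = X²`.
  have key : A.charmatrix *ᵥ ((C a * (X - C l₂)) • (fun i => C (w₁ i)) +
      (C b * (X - C l₁)) • (fun i => C (w₂ i))) =
      ((X - C l₁) * (X - C l₂)) • fun i => C ((a • w₁ + b • w₂) i) := by
    rw [mulVec_add, mulVec_smul, mulVec_smul, charmatrix_mulVec_C A h₁, charmatrix_mulVec_C A h₂]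
    ext1 i
    simp
    ring
  have := det_mul_eq_mul_det_add_vecMulVec A.charmatrix
    (mul_ne_zero (X_sub_C_ne_zero l₁) (X_sub_C_ne_zero l₂)) _ _ (fun i => C (r i)) key
  rw [add_dotProduct, smul_dotProduct, smul_dotProduct, C_dotProduct_C, C_dotProduct_C,
    ← charmatrix_sub_vecMulVec] at this
  rw [charpoly, charpoly, ← this]
  congr 1
  have e1 : a * (w₁ ⬝ᵥ r) = l₁ ^ 2 / (l₁ - l₂) := by rw [ha]; field_simp
  have e2 : b * (w₂ ⬝ᵥ r) = - (l₂ ^ 2 / (l₁ - l₂)) := by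
    rw [hb, ← neg_sub l₁ l₂]; field_simp
  have e3 : a * (w₁ ⬝ᵥ r) + b * (w₂ ⬝ᵥ r) = l₁ + l₂ := by rw [e1, e2]; field_simp; ring
  have e4 : a * (w₁ ⬝ᵥ r) * l₂ + b * (w₂ ⬝ᵥ r) * l₁ = l₁ * l₂ := by
    rw [e1, e2]; field_simp; ring
  have e3' := congrArg (C : K → K[X]) e3
  have e4' := congrArg (C : K → K[X]) e4
  simp only [C_add, C_mul] at e3' e4'
  simp only [smul_eq_mul]
  linear_combination e4' - X * e3'

end PoleShift

/-! ### Powers of Schur stable matrices. -/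

section SchurStability

attribute [local instance] Matrix.linftyOpNormedRing Matrix.linftyOpNormedAlgebra

/-- By Gelfand's formula `‖Mᵏ‖` is eventually below `rᵏ` for some `r < 1` exceeding the spectral
radius. -/
theorem tendsto_pow_of_spectrum_norm_lt_one {n : ℕ} (M : Matrix (Fin n) (Fin n) ℂ)
    (h : ∀ μ ∈ spectrum ℂ M, ‖μ‖ < 1) : Tendsto (fun k => M ^ k) atTop (𝓝 0) := by
  rcases isEmpty_or_nonempty (Fin n) with hn | hn
  · exact tendsto_const_nhds.congr fun k => Subsingleton.elim _ _
  have hlt : spectralRadius ℂ M < (1 : NNReal) :=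
    spectrum.spectralRadius_lt_of_forall_lt M fun z hz => by
      exact_mod_cast h z hz
  obtain ⟨r, hr, hr1⟩ := ENNReal.lt_iff_exists_nnreal_btwn.1 hlt
  have hev := (spectrum.pow_nnnorm_pow_one_div_tendsto_nhds_spectralRadius M).eventually_lt_const hr
  have hr1' : r < 1 := by exact_mod_cast hr1
  refine tendsto_zero_iff_norm_tendsto_zero.2 (squeeze_zero' (Eventually.of_forall fun _ => norm_nonneg _) ?_
    (tendsto_pow_atTop_nhds_zero_of_lt_one r.coe_nonneg (by exact_mod_cast hr1')))
  filter_upwards [hev, eventually_gt_atTop 0] with k hk hk0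
  have hk' : (0 : ℝ) < k := by exact_mod_cast hk0
  rw [one_div, ENNReal.rpow_inv_lt_iff hk', ENNReal.rpow_natCast] at hk
  exact le_of_lt (by exact_mod_cast hk)

theorem IsSchurStable.tendsto_pow_mulVec {n : ℕ} {M : Matrix (Fin n) (Fin n) ℝ}
    (h : IsSchurStable M) (e : Fin n → ℝ) : Tendsto (fun k => M ^ k *ᵥ e) atTop (𝓝 0) := by
  have h1 := tendsto_pow_of_spectrum_norm_lt_one _ h
  have h2 : ∀ k, M ^ k = (toComplex M ^ k).map Complex.re := fun k => by
    have : toComplex M ^ k = toComplex (M ^ k) :=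
      (map_pow (Complex.ofRealHom.mapMatrix) M k).symm
    rw [this]
    ext i j
    simp
  have h3 : Continuous fun N : Matrix (Fin n) (Fin n) ℂ => N.map Complex.re *ᵥ e :=
    (continuous_id.matrix_map Complex.continuous_re).matrix_mulVec continuous_const
  have h4 := (h3.tendsto 0).comp h1
  simp only [Function.comp_def] at h4
  simp only [h2]
  convert h4 using 2
  ext i
  simp [mulVec, dotProduct]

end SchurStability

theorem re_toComplex_mulVec {ι κ : Type*} [Fintype κ] (M : Matrix ι κ ℝ) (v : κ → ℂ) (i : ι) :
    ((toComplex M *ᵥ v) i).re = (M *ᵥ fun j => (v j).re) i := by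
  simp [mulVec, dotProduct]

theorem im_toComplex_mulVec {ι κ : Type*} [Fintype κ] (M : Matrix ι κ ℝ) (v : κ → ℂ) (i : ι) :
    ((toComplex M *ᵥ v) i).im = (M *ᵥ fun j => (v j).im) i := by
  simp [mulVec, dotProduct]

theorem toComplex_mulVec_star {ι κ : Type*} [Fintype κ] (M : Matrix ι κ ℝ) (v : κ → ℂ) :
    toComplex M *ᵥ star v = star (toComplex M *ᵥ v) := by
  ext i
  simp [mulVec, dotProduct]

theorem mem_spectrum_iff_exists_mulVec {ι K : Type*} [Fintype ι] [DecidableEq ι] [Field K]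
    (M : Matrix ι ι K) (l : K) : l ∈ spectrum K M ↔ ∃ w ≠ 0, M *ᵥ w = l • w := by
  rw [spectrum.mem_iff, Matrix.isUnit_iff_isUnit_det, isUnit_iff_ne_zero, not_not,
    ← Matrix.exists_mulVec_eq_zero_iff]
  refine exists_congr fun w => and_congr_right fun _ => ?_
  rw [sub_mulVec, algebraMap_eq_diagonal, sub_eq_zero, eq_comm]
  simp [funext_iff, mulVec_diagonal]

/-! ### Stabilization of detectable pairs. -/

section OutputInjection

open Polynomial

/-- The number, with multiplicity, of complex eigenvalues outside the open unit disc. -/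
noncomputable def unstableCount {n : ℕ} (M : Matrix (Fin n) (Fin n) ℝ) : ℕ := by
  classical exact ((toComplex M).charpoly.roots.filter fun z => 1 ≤ ‖z‖).card

theorem card_filter_roots_mul {p q : ℂ[X]} (hp : p ≠ 0) (hq : q ≠ 0) (P : ℂ → Prop)
    [DecidablePred P] : ((p * q).roots.filter P).card =
      (p.roots.filter P).card + (q.roots.filter P).card := by
  rw [roots_mul (mul_ne_zero hp hq), Multiset.filter_add, Multiset.card_add]

/-- A real unstable eigenvalue which is visible through the row `c` can be moved to the origin. -/
theorem unstableCount_lt_of_real {n : ℕ} (A : Matrix (Fin n) (Fin n) ℝ) {w c : Fin n → ℝ} {l : ℝ}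
    (hl : 1 ≤ |l|) (hw : A *ᵥ w = l • w) (hc : w ⬝ᵥ c ≠ 0) :
    ∃ g, unstableCount (A - vecMulVec g c) < unstableCount A := by
  classical
  refine ⟨(l / (w ⬝ᵥ c)) • w, ?_⟩
  have h := charpoly_mul_X_eq (r := (l / (w ⬝ᵥ c)) • c) A hw (by
    rw [dotProduct_smul, smul_eq_mul, div_mul_cancel₀ _ hc])
  rw [vecMulVec_smul, ← smul_vecMulVec] at h
  have h' := congrArg (Polynomial.map Complex.ofRealHom) h
  simp only [Polynomial.map_mul, Polynomial.map_X, Polynomial.map_sub, Polynomial.map_C,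
    ← charpoly_map] at h'
  have h2 := congrArg (fun p : ℂ[X] => (p.roots.filter fun z => 1 ≤ ‖z‖).card) h'
  rw [card_filter_roots_mul (charpoly_monic _).ne_zero X_ne_zero,
    card_filter_roots_mul (X_sub_C_ne_zero _) (charpoly_monic _).ne_zero, roots_X, roots_X_sub_C,
    Multiset.filter_singleton, Multiset.filter_singleton, if_neg (by simp),
    if_pos (by simpa using hl)] at h2
  unfold unstableCount
  simp only [Multiset.card_singleton, Multiset.empty_eq_zero, Multiset.card_zero] at h2
  change _ + 0 = 1 + _ at h2
  have e : ∀ M : Matrix (Fin n) (Fin n) ℝ, M.map Complex.ofRealHom = toComplex M := fun _ => rfl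
  rw [e, e] at h2
  omega

/-- A non-real unstable eigenvalue which is visible through the row `c` can be moved to the origin
together with its conjugate. -/
theorem unstableCount_lt_of_complex {n : ℕ} (A : Matrix (Fin n) (Fin n) ℝ) {w : Fin n → ℂ}
    {c : Fin n → ℝ} {l : ℂ} (hl : 1 ≤ ‖l‖) (him : l.im ≠ 0) (hw : toComplex A *ᵥ w = l • w)
    (hc : w ⬝ᵥ (fun i => (c i : ℂ)) ≠ 0) :
    ∃ g, unstableCount (A - vecMulVec g c) < unstableCount A := by
  classical
  have hw' : toComplex A *ᵥ star w = star l • star w := by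
    rw [toComplex_mulVec_star, hw, star_smul]
  have hcs : star w ⬝ᵥ (fun i => (c i : ℂ)) = star (w ⬝ᵥ (fun i => (c i : ℂ))) := by
    simp [dotProduct]
  have hne : l ≠ star l := fun h => him (Complex.conj_eq_iff_im.1 h.symm)
  have h := charpoly_mul_X_sq_eq (toComplex A) hw hw' hne hc (by rw [hcs]; simpa using hc)
  set ρ := l ^ 2 / ((w ⬝ᵥ (fun i => (c i : ℂ))) * (l - star l)) with hρ
  -- The two weights are conjugate, so the update direction `ρw + conj(ρw)` is real.
  have hρ' : (star l) ^ 2 / ((star w ⬝ᵥ (fun i => (c i : ℂ))) * (star l - l)) = star ρ := by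
    rw [hρ, hcs]; simp
  rw [hρ'] at h
  refine ⟨fun i => 2 * (ρ * w i).re, ?_⟩
  have e : toComplex A - vecMulVec (ρ • w + star ρ • star w) (fun i => (c i : ℂ)) =
      toComplex (A - vecMulVec (fun i => 2 * (ρ * w i).re) c) := by
    ext i j
    have : ρ * w i + star ρ * star (w i) = ((2 * (ρ * w i).re : ℝ) : ℂ) := by
      rw [← Complex.add_conj]; simp
    simp only [Matrix.sub_apply, vecMulVec_apply, map_apply, Pi.add_apply, Pi.smul_apply, Pi.star_apply,
      smul_eq_mul, this, Complex.ofReal_sub, Complex.ofReal_mul]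
  rw [e] at h
  have h2 := congrArg (fun p : ℂ[X] => (p.roots.filter fun z => 1 ≤ ‖z‖).card) h
  rw [card_filter_roots_mul (charpoly_monic _).ne_zero (pow_ne_zero _ X_ne_zero),
    card_filter_roots_mul (mul_ne_zero (X_sub_C_ne_zero _) (X_sub_C_ne_zero _))
      (charpoly_monic _).ne_zero,
    card_filter_roots_mul (X_sub_C_ne_zero _) (X_sub_C_ne_zero _), pow_two,
    card_filter_roots_mul X_ne_zero X_ne_zero, roots_X, roots_X_sub_C, roots_X_sub_C,
    Multiset.filter_singleton, Multiset.filter_singleton, Multiset.filter_singleton,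
    if_neg (by simp), if_pos hl, if_pos (by simpa using hl)] at h2
  unfold unstableCount
  change _ + (0 + 0) = 1 + 1 + _ at h2
  omega

/-- A detectable real pair admits a stabilizing output injection. -/
theorem exists_isSchurStable_sub_mul {n : ℕ} {ι : Type*} [Fintype ι]
    (A : Matrix (Fin n) (Fin n) ℝ) (H : Matrix ι (Fin n) ℝ)
    (hdet : ∀ (l : ℂ) (w : Fin n → ℂ), 1 ≤ ‖l‖ → toComplex A *ᵥ w = l • w →
      toComplex H *ᵥ w = 0 → w = 0) :
    ∃ G : Matrix (Fin n) ι ℝ, IsSchurStable (A - G * H) := by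
  classical
  -- Detectability makes some row of `H` see an unstable eigenvector; an injection through that row
  -- lowers the count of unstable eigenvalues.
  induction hN : unstableCount A using Nat.strong_induction_on generalizing A with
  | _ N ih =>
    by_cases hs : IsSchurStable A
    · exact ⟨0, by simpa using hs⟩
    obtain ⟨l, hmem, hl⟩ : ∃ l ∈ spectrum ℂ (toComplex A), 1 ≤ ‖l‖ := by
      simpa [IsSchurStable] using hs
    obtain ⟨w, hw0, hw⟩ := (mem_spectrum_iff_exists_mulVec _ _).1 hmem
    obtain ⟨i, hi⟩ := Function.ne_iff.1 fun h => hw0 (hdet l w hl hw h)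
    have hc : w ⬝ᵥ (fun j => (H i j : ℂ)) ≠ 0 := by
      rw [dotProduct_comm]; exact hi
    obtain ⟨g, hg⟩ : ∃ g, unstableCount (A - vecMulVec g (H i)) < unstableCount A := by
      by_cases him : l.im = 0
      · have hlr : l = (l.re : ℂ) := Complex.ext rfl (by simpa using him)
        have hl' : 1 ≤ |l.re| := by rw [hlr] at hl; simpa using hl
        have hre : A *ᵥ (fun j => (w j).re) = l.re • fun j => (w j).re := by
          ext j
          rw [← re_toComplex_mulVec, hw]
          simp [him]
        have hIm : A *ᵥ (fun j => (w j).im) = l.re • fun j => (w j).im := by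
          ext j
          rw [← im_toComplex_mulVec, hw]
          simp [him]
        -- For real `l` the real and imaginary parts of `w` both satisfy the eigenvector equation,
        -- and row `i` sees at least one of them.
        by_cases h1 : (fun j => (w j).re) ⬝ᵥ H i = 0
        · refine unstableCount_lt_of_real A hl' hIm fun h2 => hc ?_
          apply Complex.ext
          · simpa [dotProduct] using h1
          · simpa [dotProduct] using h2
        · exact unstableCount_lt_of_real A hl' hre h1
      · exact unstableCount_lt_of_complex A hl him hw hc
    have hgH : vecMulVec g (H i) = vecMulVec g (Pi.single i 1) * H := by
      rw [vecMulVec_mul, single_one_vecMul]; rfl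
    rw [hgH] at hg
    obtain ⟨G, hG⟩ := ih _ (hN ▸ hg) (A - vecMulVec g (Pi.single i 1) * H) (fun l w hl hw hH => by
      -- Output injection preserves detectability: on the kernel of `H` the old and new matrices
      -- agree.
      refine hdet l w hl ?_ hH
      have e : toComplex A = toComplex (A - vecMulVec g (Pi.single i 1) * H) +
          toComplex (vecMulVec g (Pi.single i 1)) * toComplex H := by
        have : toComplex (vecMulVec g (Pi.single i 1)) * toComplex H =
          toComplex (vecMulVec g (Pi.single i 1) * H) := (Matrix.map_mul (f := Complex.ofRealHom)).symm
        rw [this]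
        ext i j
        simp
      rw [e, add_mulVec, hw, ← mulVec_mulVec, hH, mulVec_zero, add_zero]) rfl
    exact ⟨vecMulVec g (Pi.single i 1) + G, by rwa [Matrix.add_mul, ← sub_sub]⟩

end OutputInjection

section ToComplex

variable {ι κ o : Type*}

theorem toComplex_mul [Fintype κ] (M : Matrix ι κ ℝ) (N : Matrix κ o ℝ) :
    toComplex (M * N) = toComplex M * toComplex N :=
  Matrix.map_mul (f := Complex.ofRealHom)

theorem toComplex_sub (M N : Matrix ι κ ℝ) : toComplex (M - N) = toComplex M - toComplex N := by
  ext; simp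

theorem toComplex_mulVec_eq_zero_iff [Fintype κ] [Fintype ι] (M : Matrix ι κ ℝ)
    (h : M.rank = Fintype.card κ) (v : κ → ℂ) : toComplex M *ᵥ v = 0 ↔ v = 0 := by
  refine ⟨fun hv => ?_, fun hv => by rw [hv, mulVec_zero]⟩
  refine (rank_eq_card_iff (toComplex M)).1 ?_ v hv
  exact (rank_map_ringHom Complex.ofRealHom M).trans h

theorem toComplex_mulVec_add_I_mul [Fintype κ] (M : Matrix ι κ ℝ) (a b : κ → ℝ) :
    toComplex M *ᵥ (fun j => (a j : ℂ) + Complex.I * b j) =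
      fun i => ((M *ᵥ a) i : ℂ) + Complex.I * ((M *ᵥ b) i : ℂ) := by
  ext i
  simp only [mulVec, dotProduct, map_apply, Complex.ofReal_sum, Finset.mul_sum,
    ← Finset.sum_add_distrib, Complex.ofReal_mul]
  exact Finset.sum_congr rfl fun _ _ => by ring

end ToComplex

/-! ### Model-based side: observers and the pencil. -/

namespace DescriptorSystem

variable {n m p q : ℕ} (sys : DescriptorSystem n m p q)

/-- Under the matching condition, the pair formed by `x(k)` and the known signals determines
`x(k+1)`. -/
theorem eq_zero_of_matching (hmatch : (fromBlocks sys.E sys.F sys.C 0).rank = n + q)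
    {x : Fin n → ℝ} {η : Fin q → ℝ} (hE : sys.E *ᵥ x = sys.F *ᵥ η) (hC : sys.C *ᵥ x = 0) :
    x = 0 := by
  have := (rank_eq_card_iff (fromBlocks sys.E sys.F sys.C 0)).1 (by simpa using hmatch)
    (Sum.elim x (-η)) (by
      rw [fromBlocks_mulVec]
      ext (i | i) <;> simp [mulVec_neg, hE, hC])
  ext i
  exact congrFun this (Sum.inl i)

/-- If `L` is a left inverse of `M = [E F; C 0]`, then `1 - ML` annihilates `M` from the left. Hence
any multiple `G₂` of its first block row may be subtracted from the first block row of `L`. The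
matrix to stabilize becomes `L₁₁A - [G₁ G₂][C; NA]` with `N = 1 - EL₁₁ - FL₂₁`. -/
theorem exists_isSchurStable_of_rank (hmatch : (fromBlocks sys.E sys.F sys.C 0).rank = n + q)
    (hrank : ∀ lam : ℂ, 1 ≤ ‖lam‖ →
      (fromBlocks (lam • toComplex sys.E - toComplex sys.A) (-toComplex sys.F)
        (toComplex sys.C) 0).rank = n + q) :
    ∃ (W₁ : Matrix (Fin n) (Fin n) ℝ) (W₂ G : Matrix (Fin n) (Fin p) ℝ),
      W₁ * sys.E + W₂ * sys.C = 1 ∧ W₁ * sys.F = 0 ∧ IsSchurStable (W₁ * sys.A - G * sys.C) := by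
  obtain ⟨L, hL⟩ := exists_left_inverse_of_rank_eq (fromBlocks sys.E sys.F sys.C 0)
    (by simpa using hmatch)
  rw [← fromBlocks_toBlocks L, fromBlocks_multiply, ← fromBlocks_one, fromBlocks_inj] at hL
  obtain ⟨h₁₁, h₁₂, h₂₁, h₂₂⟩ := hL
  generalize L.toBlocks₁₁ = L₁₁ at *
  generalize L.toBlocks₁₂ = L₁₂ at *
  generalize L.toBlocks₂₁ = L₂₁ at *
  generalize L.toBlocks₂₂ = L₂₂ at *
  simp only [Matrix.mul_zero, add_zero] at h₁₂ h₂₂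
  obtain ⟨G, hG⟩ := exists_isSchurStable_sub_mul (L₁₁ * sys.A)
    (fromRows sys.C ((1 - sys.E * L₁₁ - sys.F * L₂₁) * sys.A)) (fun l w hl hw hH => by
      have hC : toComplex sys.C *ᵥ w = 0 := by
        ext i; exact congrFun hH (Sum.inl i)
      have hN : toComplex ((1 - sys.E * L₁₁ - sys.F * L₂₁) * sys.A) *ᵥ w = 0 := by
        ext i; exact congrFun hH (Sum.inr i)
      rw [Matrix.sub_mul, Matrix.sub_mul, Matrix.one_mul, Matrix.mul_assoc, Matrix.mul_assoc,
        toComplex_sub, toComplex_sub, toComplex_mul sys.E, toComplex_mul sys.F, sub_mulVec, sub_mulVec,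
        ← mulVec_mulVec, hw] at hN
      -- `NAw = 0` and `L₁₁Aw = lw` give `Aw = lEw + FL₂₁Aw`, which puts `(w, -L₂₁Aw)` in the kernel
      -- of the pencil.
      have := (rank_eq_card_iff _).1 ((hrank l hl).trans (by simp))
        (Sum.elim w (-(toComplex (L₂₁ * sys.A) *ᵥ w))) (by
          rw [fromBlocks_mulVec]
          ext (i | i)
          · have := congrFun hN i
            simp only [Pi.sub_apply, mulVec_smul, Pi.zero_apply, Pi.smul_apply, smul_eq_mul] at this
            simp [sub_mulVec, smul_mulVec, mulVec_neg, neg_mulVec]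
            linear_combination -this
          · simp [hC])
      ext i
      exact congrFun this (Sum.inl i))
  rw [← fromCols_toCols G, fromCols_mul_fromRows] at hG
  generalize G.toCols₁ = G₁ at *
  generalize G.toCols₂ = G₂ at *
  refine ⟨L₁₁ - G₂ * (1 - sys.E * L₁₁ - sys.F * L₂₁),
    L₁₂ + G₂ * (sys.E * L₁₂ + sys.F * L₂₂), G₁, ?_, ?_, ?_⟩
  · have e₁ : L₁₁ * sys.E = 1 - L₁₂ * sys.C := eq_sub_of_add_eq h₁₁
    have e₂ : L₂₁ * sys.E = - (L₂₂ * sys.C) := eq_neg_of_add_eq_zero_left h₂₁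
    simp only [Matrix.sub_mul, Matrix.mul_sub, Matrix.add_mul, Matrix.mul_add, Matrix.mul_assoc,
      Matrix.mul_one, e₁, e₂, Matrix.mul_neg]
    abel
  · simp only [Matrix.sub_mul, Matrix.mul_sub, Matrix.mul_assoc, h₁₂, h₂₂, Matrix.mul_one,
      Matrix.mul_zero]
    simp
  · convert hG using 1
    simp only [Matrix.sub_mul, Matrix.mul_assoc]
    abel

variable {sys}

theorem state_update {W₁ : Matrix (Fin n) (Fin n) ℝ} {W₂ : Matrix (Fin n) (Fin p) ℝ}
    (h₁ : W₁ * sys.E + W₂ * sys.C = 1) (h₂ : W₁ * sys.F = 0) (G : Matrix (Fin n) (Fin p) ℝ)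
    {x₀ x₁ : Fin n → ℝ} {u : Fin m → ℝ} {η : Fin q → ℝ}
    (h : sys.E *ᵥ x₁ = sys.A *ᵥ x₀ + sys.B *ᵥ u + sys.F *ᵥ η) :
    x₁ = (W₁ * sys.A - G * sys.C) *ᵥ x₀ + (W₁ * sys.B) *ᵥ u + G *ᵥ (sys.C *ᵥ x₀) +
      W₂ *ᵥ (sys.C *ᵥ x₁) := by
  have h' := congrArg (W₁ *ᵥ ·) h
  simp only [mulVec_add, mulVec_mulVec, h₂, zero_mulVec, add_zero] at h'
  calc x₁ = (W₁ * sys.E + W₂ * sys.C) *ᵥ x₁ := by rw [h₁, one_mulVec]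
    _ = _ := by
      rw [add_mulVec, h', sub_mulVec, mulVec_mulVec, mulVec_mulVec]
      abel

theorem exists_observer {W₁ : Matrix (Fin n) (Fin n) ℝ} {W₂ G : Matrix (Fin n) (Fin p) ℝ}
    (h₁ : W₁ * sys.E + W₂ * sys.C = 1) (h₂ : W₁ * sys.F = 0)
    (hs : IsSchurStable (W₁ * sys.A - G * sys.C)) :
    sys.IsUnknownInputObserver (W₁ * sys.A - G * sys.C) (W₁ * sys.B) G W₂ := by
  intro u η x y xhat htr hxhat
  have hstep : ∀ k, x (k + 1) - xhat (k + 1) =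
      (W₁ * sys.A - G * sys.C) *ᵥ (x k - xhat k) := fun k => by
    have := state_update h₁ h₂ G (htr k).1
    rw [← (htr k).2, ← (htr (k + 1)).2] at this
    rw [mulVec_sub, hxhat k, this]
    abel
  have hpow : ∀ k, x k - xhat k = (W₁ * sys.A - G * sys.C) ^ k *ᵥ (x 0 - xhat 0) := fun k => by
    induction k with
    | zero => simp
    | succ k ih => rw [hstep, ih, mulVec_mulVec, pow_succ']
  have ht := hs.tendsto_pow_mulVec (x 0 - xhat 0)
  have hc := (((PiLp.continuous_toLp 2 fun _ : Fin n => ℝ).norm).tendsto 0).comp ht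
  simp only [Function.comp_def, WithLp.toLp_zero, norm_zero] at hc
  exact hc.congr fun k => by rw [hpow k]

/-- Real parts of a modal solution `λᵏ w` form a trajectory with vanishing known input and
output. -/
theorem isTrajectory_re {lam : ℂ} {w : Fin n → ℂ} {v : Fin q → ℂ}
    (hE : lam • (toComplex sys.E *ᵥ w) = toComplex sys.A *ᵥ w + toComplex sys.F *ᵥ v)
    (hC : toComplex sys.C *ᵥ w = 0) :
    sys.IsTrajectory (fun _ => 0) (fun k i => (lam ^ k * v i).re) (fun k i => (lam ^ k * w i).re)
      (fun _ => 0) := by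
  intro k
  constructor
  · ext i
    have e₁ := re_toComplex_mulVec sys.E (lam ^ (k + 1) • w) i
    have e₂ := re_toComplex_mulVec sys.A (lam ^ k • w) i
    have e₃ := re_toComplex_mulVec sys.F (lam ^ k • v) i
    simp only [Pi.smul_apply, smul_eq_mul] at e₁ e₂ e₃
    have h := congrFun hE i
    simp only [Pi.smul_apply, smul_eq_mul, Pi.add_apply] at h
    simp only [Pi.add_apply, mulVec_zero, add_zero, ← e₁, ← e₂, ← e₃,
      ← Complex.add_re]
    congr 1
    simp only [mulVec_smul, Pi.smul_apply, smul_eq_mul]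
    linear_combination lam ^ k * h
  · ext i
    have e := re_toComplex_mulVec sys.C (lam ^ k • w) i
    simp only [Pi.smul_apply, smul_eq_mul, mulVec_smul, hC] at e
    simpa using e

theorem tendsto_re_of_observer {AO : Matrix (Fin n) (Fin n) ℝ} {BOu : Matrix (Fin n) (Fin m) ℝ}
    {BOy NO : Matrix (Fin n) (Fin p) ℝ} (hO : sys.IsUnknownInputObserver AO BOu BOy NO)
    {lam : ℂ} {w : Fin n → ℂ} {v : Fin q → ℂ}
    (hE : lam • (toComplex sys.E *ᵥ w) = toComplex sys.A *ᵥ w + toComplex sys.F *ᵥ v)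
    (hC : toComplex sys.C *ᵥ w = 0) (i : Fin n) :
    Tendsto (fun k => (lam ^ k * w i).re) atTop (𝓝 0) := by
  -- Known input and output vanish, so the zero sequence is an admissible estimate and the error is
  -- the state itself.
  have h := hO _ _ _ _ (fun _ => 0) (isTrajectory_re hE hC) (fun k => by simp)
  refine squeeze_zero_norm (fun k => ?_) h
  have := PiLp.norm_apply_le (WithLp.toLp 2 ((fun i => (lam ^ k * w i).re) - (0 : Fin n → ℝ))) i
  simpa using this

theorem eq_zero_of_observer {AO : Matrix (Fin n) (Fin n) ℝ} {BOu : Matrix (Fin n) (Fin m) ℝ}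
    {BOy NO : Matrix (Fin n) (Fin p) ℝ} (hO : sys.IsUnknownInputObserver AO BOu BOy NO)
    {lam : ℂ} (hlam : 1 ≤ ‖lam‖) {w : Fin n → ℂ} {v : Fin q → ℂ}
    (hE : lam • (toComplex sys.E *ᵥ w) = toComplex sys.A *ᵥ w + toComplex sys.F *ᵥ v)
    (hC : toComplex sys.C *ᵥ w = 0) : w = 0 := by
  ext i
  have h₁ := tendsto_re_of_observer hO hE hC i
  -- Multiplication by `-i` turns the imaginary part into a real part.
  have h₂ := tendsto_re_of_observer hO (w := (-Complex.I) • w) (v := (-Complex.I) • v) (lam := lam)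
    (by rw [mulVec_smul, mulVec_smul, mulVec_smul, smul_comm, hE, smul_add])
    (by rw [mulVec_smul, hC, smul_zero]) i
  have h₃ : Tendsto (fun k => |(lam ^ k * w i).re| + |(lam ^ k * w i).im|) atTop (𝓝 0) := by
    have := h₁.abs.add h₂.abs
    simp only [abs_zero, add_zero] at this
    refine this.congr fun k => ?_
    congr 2
    simp [mul_left_comm]
  have h₄ : ‖w i‖ ≤ 0 := ge_of_tendsto' h₃ fun k => calc
    ‖w i‖ ≤ ‖lam‖ ^ k * ‖w i‖ := le_mul_of_one_le_left (norm_nonneg _) (one_le_pow₀ hlam)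
    _ = ‖lam ^ k * w i‖ := by rw [norm_mul, norm_pow]
    _ ≤ _ := Complex.norm_le_abs_re_add_abs_im _
  simpa using h₄

/-- Injectivity of the pencil `[λE - A, -F; C, 0]` only has to be tested on the state part. -/
theorem rank_pencil_eq (hmatch : (fromBlocks sys.E sys.F sys.C 0).rank = n + q) {lam : ℂ}
    (h : ∀ (w : Fin n → ℂ) (v : Fin q → ℂ),
      lam • (toComplex sys.E *ᵥ w) = toComplex sys.A *ᵥ w + toComplex sys.F *ᵥ v →
      toComplex sys.C *ᵥ w = 0 → w = 0) :
    (fromBlocks (lam • toComplex sys.E - toComplex sys.A) (-toComplex sys.F)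
        (toComplex sys.C) 0).rank = n + q := by
  suffices H : _ = Fintype.card (Fin n ⊕ Fin q) by simpa using H
  rw [rank_eq_card_iff]
  intro z hz
  obtain ⟨w, v, rfl⟩ : ∃ w v, z = Sum.elim w v := ⟨_, _, (Sum.elim_comp_inl_inr z).symm⟩
  rw [fromBlocks_mulVec] at hz
  have hE : lam • (toComplex sys.E *ᵥ w) = toComplex sys.A *ᵥ w + toComplex sys.F *ᵥ v := by
    ext i
    have := congrFun hz (Sum.inl i)
    simp [sub_mulVec, smul_mulVec, neg_mulVec] at this
    simp
    linear_combination this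
  have hC : toComplex sys.C *ᵥ w = 0 := by
    ext i
    have := congrFun hz (Sum.inr i)
    simpa using this
  have hw := h w v hE hC
  subst hw
  have hF : toComplex sys.F *ᵥ v = 0 := by simpa using hE.symm
  have := (toComplex_mulVec_eq_zero_iff _ (hmatch.trans (by simp)) (Sum.elim 0 v)).1 (by
    rw [toComplex, fromBlocks_map, fromBlocks_mulVec]
    ext (i | i)
    · simpa using congrFun hF i
    · simp)
  exact this

end DescriptorSystem

/-! ### Slow and fast parts of homogeneous solutions. -/

namespace DescriptorSystem

variable {n m p q n₁ n₂ s : ℕ} {sys : DescriptorSystem n m p q}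

/-- A solution of the homogeneous descriptor equation whose slow part starts at the origin
vanishes. -/
theorem Decomposition.eq_zero_of_homogeneous (D : sys.Decomposition n₁ n₂ s)
    (x : ℕ → Fin n → ℝ) (h : ∀ k ≤ s, sys.E *ᵥ x (k + 1) = sys.A *ᵥ x k)
    (h0 : D.slowState (x 0) = 0) : x 0 = 0 ∧ x 1 = 0 := by
  set e := finSumFinEquiv.trans (finCongr D.dim_eq) with he
  set z : ℕ → Fin n₁ ⊕ Fin n₂ → ℝ := fun k => (D.P⁻¹ *ᵥ x k) ∘ e with hz
  have hP : IsUnit D.P.det := (isUnit_iff_isUnit_det _).1 D.isUnit_P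
  have hxz : ∀ k, x k = D.P *ᵥ (D.P⁻¹ *ᵥ x k) := fun k => by
    rw [mulVec_mulVec, mul_nonsing_inv _ hP, one_mulVec]
  have hre : ∀ (M : Matrix (Fin n₁ ⊕ Fin n₂) (Fin n₁ ⊕ Fin n₂) ℝ) k,
      (M.reindex e e *ᵥ (D.P⁻¹ *ᵥ x k)) ∘ e = M *ᵥ z k := fun M k => by
    rw [reindex_apply, submatrix_mulVec_equiv, Equiv.symm_symm, Function.comp_assoc,
      Equiv.symm_comp_self, Function.comp_id]
  have hstep : ∀ k ≤ s, fromBlocks 1 0 0 D.R *ᵥ z (k + 1) = fromBlocks D.A₁ 0 0 1 *ᵥ z k :=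
    fun k hk => by
      rw [← hre, ← hre, ← D.decomp_E, ← D.decomp_A]
      simp only [← mulVec_mulVec, ← hxz, h k hk]
  have hslow : ∀ k ≤ s, z (k + 1) ∘ Sum.inl = D.A₁ *ᵥ (z k ∘ Sum.inl) := fun k hk => by
    have := hstep k hk
    rw [fromBlocks_mulVec, fromBlocks_mulVec] at this
    ext i
    simpa using congrFun this (Sum.inl i)
  have hfast : ∀ k ≤ s, D.R *ᵥ (z (k + 1) ∘ Sum.inr) = z k ∘ Sum.inr := fun k hk => by
    have := hstep k hk
    rw [fromBlocks_mulVec, fromBlocks_mulVec] at this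
    ext i
    simpa using congrFun this (Sum.inr i)
  have hpow : ∀ i j, i + j ≤ s + 1 → D.R ^ j *ᵥ (z (i + j) ∘ Sum.inr) = z i ∘ Sum.inr := by
    intro i j
    induction j with
    | zero => simp
    | succ j ih =>
      intro hij
      rw [pow_succ, ← mulVec_mulVec, ← add_assoc, hfast (i + j) (by omega), ih (by omega)]
  have hzero : ∀ k, z k ∘ Sum.inl = 0 → z k ∘ Sum.inr = 0 → x k = 0 := fun k hl hr => by
    have : D.P⁻¹ *ᵥ x k = 0 := by
      ext i
      obtain ⟨j | j, rfl⟩ := e.surjective i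
      · exact congrFun hl j
      · exact congrFun hr j
    rw [hxz k, this, mulVec_zero]
  have hl0 : z 0 ∘ Sum.inl = 0 := h0
  -- The fast part at time `i` is `Rˢ` applied to that at time `i + s`. Reaching `i = 1` needs the
  -- equation for `k = 0, …, s`, which is why the Hankel matrices have depth `s + 1`.
  have hr : ∀ i ≤ 1, z i ∘ Sum.inr = 0 := fun i hi => by
    rw [← hpow i s (by omega), D.nilpotent, zero_mulVec]
  exact ⟨hzero 0 hl0 (hr 0 (by omega)),
    hzero 1 (by rw [hslow 0 (by omega), hl0, mulVec_zero]) (hr 1 le_rfl)⟩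

theorem Decomposition.slowState_sub (D : sys.Decomposition n₁ n₂ s) (x x' : Fin n → ℝ) :
    D.slowState (x - x') = D.slowState x - D.slowState x' := by
  ext i
  simp [slowState, mulVec_sub]

theorem Decomposition.slowState_sum (D : sys.Decomposition n₁ n₂ s) {T : ℕ}
    (c : Fin T → ℝ) (x : Fin T → Fin n → ℝ) :
    D.slowState (∑ j, c j • x j) = ∑ j, c j • D.slowState (x j) := by
  ext i
  simp [slowState, mulVec_sum, mulVec_smul, Finset.sum_apply]

end DescriptorSystem

/-! ### Data-driven side. -/

namespace Data

open DescriptorSystem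

variable {n m p q n₁ n₂ s T : ℕ} {sys : DescriptorSystem n m p q} {d : Data n m p T s}
  {ηd : Fin (T + s) → Fin q → ℝ}

/-- Rich data generate the initial pair of states of every trajectory. -/
theorem exists_coeff (D : sys.Decomposition n₁ n₂ s) (hdata : d.CollectedFrom sys ηd)
    (hinf : d.IsInformative ηd D) {u : ℕ → Fin m → ℝ} {η : ℕ → Fin q → ℝ} {x : ℕ → Fin n → ℝ}
    {y : ℕ → Fin p → ℝ} (htr : sys.IsTrajectory u η x y) :
    ∃ c : Fin T → ℝ, d.Xp *ᵥ c = x 0 ∧ d.Xf *ᵥ c = x 1 ∧ d.Up *ᵥ c = u 0 := by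
  obtain ⟨ud, ηd', xd, yd, hd, hu, hx⟩ := hdata
  obtain ⟨Q, hQ⟩ := exists_right_inverse_of_rank_eq _ (hinf.trans (by simp; ring))
  -- Full row rank lets one combination of data columns match the initial slow state and both inputs
  -- at times `0, …, s`.
  set c := Q *ᵥ (Sum.elim (fun i => D.slowState (x 0) i.2)
    (Sum.elim (fun i => u i.1 i.2) fun i => η i.1 i.2)) with hc
  have hWc := congrArg (· *ᵥ (Sum.elim (fun i => D.slowState (x 0) i.2)
    (Sum.elim (fun i => u i.1 i.2) fun i => η i.1 i.2))) hQ
  simp only [← mulVec_mulVec, one_mulVec, ← hc, col3, fromRows_mulVec] at hWc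
  have hz : D.slowState (∑ j, c j • xd j) = D.slowState (x 0) := by
    rw [D.slowState_sum]
    ext i
    have := congrFun hWc (Sum.inl (0, i))
    simpa [hankel, mulVec, dotProduct, Finset.sum_apply, mul_comm, (hx _).1] using this
  have hU : ∀ k ≤ s, ∑ j, c j • ud (j + k) = u k := fun k hk => by
    ext i
    have := congrFun hWc (Sum.inr (Sum.inl (⟨k, by omega⟩, i)))
    simpa [hankel, mulVec, dotProduct, Finset.sum_apply, mul_comm, (hu _).1] using this
  have hη : ∀ k ≤ s, ∑ j, c j • ηd' (j + k) = η k := fun k hk => by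
    ext i
    have := congrFun hWc (Sum.inr (Sum.inr (⟨k, by omega⟩, i)))
    simpa [hankel, mulVec, dotProduct, Finset.sum_apply, mul_comm, (hu _).2] using this
  -- States up to time `T + s` enter here; they come from the trajectory underlying the data, which
  -- is sampled only up to `T`.
  have hdiff := D.eq_zero_of_homogeneous (fun k => (∑ j, c j • xd (j + k)) - x k) (fun k hk => by
    have e : ∀ j : Fin T, (j : ℕ) + (k + 1) = j + k + 1 := fun j => by omega
    simp only [mulVec_sub, mulVec_sum, mulVec_smul, (htr k).1, e, (hd _).1, smul_add,
      Finset.sum_add_distrib, ← hU k hk, ← hη k hk]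
    abel) (by simpa [D.slowState_sub, sub_eq_zero] using hz)
  simp only [sub_eq_zero, add_zero] at hdiff
  refine ⟨c, ?_, ?_, ?_⟩
  · rw [← hdiff.1]
    ext i
    simp [Xp, mulVec, dotProduct, Finset.sum_apply, mul_comm, (hx _).1]
  · rw [← hdiff.2]
    ext i
    simp [Xf, mulVec, dotProduct, Finset.sum_apply, mul_comm, (hx _).1]
  · rw [← hU 0 (Nat.zero_le _)]
    ext i
    simp [Up, mulVec, dotProduct, Finset.sum_apply, mul_comm, (hu _).1]

theorem Yp_eq (hdata : d.CollectedFrom sys ηd) : d.Yp = sys.C * d.Xp := by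
  obtain ⟨ud, ηd', xd, yd, hd, hu, hx⟩ := hdata
  ext i j
  simp [Yp, Xp, (hx _).1, (hx _).2, (hd _).2, mul_apply, mulVec, dotProduct]

theorem Yf_eq (hdata : d.CollectedFrom sys ηd) : d.Yf = sys.C * d.Xf := by
  obtain ⟨ud, ηd', xd, yd, hd, hu, hx⟩ := hdata
  ext i j
  simp [Yf, Xf, (hx _).1, (hx _).2, (hd _).2, mul_apply, mulVec, dotProduct]

theorem E_mul_Xf_eq (hdata : d.CollectedFrom sys ηd) :
    sys.E * d.Xf = sys.A * d.Xp + sys.B * d.Up +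
      sys.F * Matrix.of fun i (j : Fin T) => ηd (Fin.castAdd s j) i := by
  obtain ⟨ud, ηd', xd, yd, hd, hu, hx⟩ := hdata
  ext i j
  have := congrFun (hd j).1 i
  simpa [Xf, Xp, Up, (hx _).1, (hu _).1, (hu _).2, mul_apply, mulVec, dotProduct] using this

/-- On such `c` the data equation reduces to `E X_f c ∈ im F` with `C X_f c = 0`, and matching
applies. -/
theorem ker_le (hdata : d.CollectedFrom sys ηd)
    (hmatch : (fromBlocks sys.E sys.F sys.C 0).rank = n + q) {c : Fin T → ℝ}
    (hXp : d.Xp *ᵥ c = 0) (hUp : d.Up *ᵥ c = 0) (hYf : d.Yf *ᵥ c = 0) : d.Xf *ᵥ c = 0 := by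
  have h := congrArg (· *ᵥ c) (E_mul_Xf_eq hdata)
  simp only [add_mulVec, ← mulVec_mulVec, hXp, hUp, mulVec_zero, zero_add] at h
  refine sys.eq_zero_of_matching hmatch h ?_
  rwa [mulVec_mulVec, ← Yf_eq hdata]

theorem ker_le_complex (hdata : d.CollectedFrom sys ηd)
    (hmatch : (fromBlocks sys.E sys.F sys.C 0).rank = n + q) {c : Fin T → ℂ}
    (hXp : toComplex d.Xp *ᵥ c = 0) (hUp : toComplex d.Up *ᵥ c = 0)
    (hYf : toComplex d.Yf *ᵥ c = 0) : toComplex d.Xf *ᵥ c = 0 := by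
  have hre : ∀ {k : ℕ} {M : Matrix (Fin k) (Fin T) ℝ}, toComplex M *ᵥ c = 0 →
      (M *ᵥ fun j => (c j).re) = 0 := fun h => by
    ext i; rw [← re_toComplex_mulVec, h]; rfl
  have hIm : ∀ {k : ℕ} {M : Matrix (Fin k) (Fin T) ℝ}, toComplex M *ᵥ c = 0 →
      (M *ᵥ fun j => (c j).im) = 0 := fun h => by
    ext i; rw [← im_toComplex_mulVec, h]; rfl
  have h₁ := ker_le hdata hmatch (hre hXp) (hre hUp) (hre hYf)
  have h₂ := ker_le hdata hmatch (hIm hXp) (hIm hUp) (hIm hYf)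
  ext i
  apply Complex.ext
  · rw [re_toComplex_mulVec, h₁]; rfl
  · rw [im_toComplex_mulVec, h₂]; rfl

/-- Rich data generate every modal solution. -/
theorem exists_coeff_complex (D : sys.Decomposition n₁ n₂ s) (hdata : d.CollectedFrom sys ηd)
    (hinf : d.IsInformative ηd D) {lam : ℂ} {w : Fin n → ℂ} {v : Fin q → ℂ}
    (hE : lam • (toComplex sys.E *ᵥ w) = toComplex sys.A *ᵥ w + toComplex sys.F *ᵥ v)
    (hC : toComplex sys.C *ᵥ w = 0) :
    ∃ c : Fin T → ℂ, toComplex d.Xp *ᵥ c = w ∧ toComplex d.Xf *ᵥ c = lam • w ∧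
      toComplex d.Up *ᵥ c = 0 := by
  obtain ⟨a, ha₁, ha₂, ha₃⟩ := exists_coeff D hdata hinf (isTrajectory_re hE hC)
  obtain ⟨b, hb₁, hb₂, hb₃⟩ := exists_coeff D hdata hinf
    (isTrajectory_re (sys := sys) (w := (-Complex.I) • w) (v := (-Complex.I) • v) (lam := lam)
      (by rw [mulVec_smul, mulVec_smul, mulVec_smul, smul_comm, hE, smul_add])
      (by rw [mulVec_smul, hC, smul_zero]))
  refine ⟨fun j => (a j : ℂ) + Complex.I * b j, ?_, ?_, ?_⟩
  · rw [toComplex_mulVec_add_I_mul, ha₁, hb₁]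
    ext i
    apply Complex.ext <;> simp
  · rw [toComplex_mulVec_add_I_mul, ha₂, hb₂]
    ext i
    apply Complex.ext
    · simp
    · simp; ring
  · rw [toComplex_mulVec_add_I_mul, ha₃, hb₃]
    ext i
    simp

theorem col4_mulVec_eq_zero_iff {ι₁ ι₂ ι₃ ι₄ κ K : Type*} [Fintype κ] [Field K]
    (M₁ : Matrix ι₁ κ K) (M₂ : Matrix ι₂ κ K) (M₃ : Matrix ι₃ κ K) (M₄ : Matrix ι₄ κ K)
    (c : κ → K) : col4 M₁ M₂ M₃ M₄ *ᵥ c = 0 ↔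
      M₁ *ᵥ c = 0 ∧ M₂ *ᵥ c = 0 ∧ M₃ *ᵥ c = 0 ∧ M₄ *ᵥ c = 0 := by
  simp only [col4, fromRows_mulVec, funext_iff, Sum.forall, Sum.elim_inl, Sum.elim_inr,
    Pi.zero_apply]

theorem col3_mulVec_eq_zero_iff {ι₁ ι₂ ι₃ κ K : Type*} [Fintype κ] [Field K]
    (M₁ : Matrix ι₁ κ K) (M₂ : Matrix ι₂ κ K) (M₃ : Matrix ι₃ κ K) (c : κ → K) :
    col3 M₁ M₂ M₃ *ᵥ c = 0 ↔ M₁ *ᵥ c = 0 ∧ M₂ *ᵥ c = 0 ∧ M₃ *ᵥ c = 0 := by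
  simp only [col3, fromRows_mulVec, funext_iff, Sum.forall, Sum.elim_inl, Sum.elim_inr,
    Pi.zero_apply]

theorem rank_col3_toComplex {ι₁ ι₂ ι₃ κ : Type*} [Fintype ι₁] [Fintype ι₂] [Fintype ι₃]
    [Fintype κ] (M₁ : Matrix ι₁ κ ℝ) (M₂ : Matrix ι₂ κ ℝ) (M₃ : Matrix ι₃ κ ℝ) :
    (col3 (toComplex M₁) (toComplex M₂) (toComplex M₃)).rank = (col3 M₁ M₂ M₃).rank := by
  rw [← rank_map_ringHom Complex.ofRealHom]
  congr 1
  ext (i | i | i) j <;> rfl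

/-- The two kernels coincide: for `c` in the first, `λX_p c = X_f c = SX X_p c`, so a nonzero `X_p
c` would be an eigenvector of `SX` for an unstable `λ`. -/
theorem rank_eq_of_isSchurStable (hdata : d.CollectedFrom sys ηd)
    (hmatch : (fromBlocks sys.E sys.F sys.C 0).rank = n + q)
    {SX : Matrix (Fin n) (Fin n) ℝ} {SU : Matrix (Fin n) (Fin m) ℝ}
    {SYp SYf : Matrix (Fin n) (Fin p) ℝ}
    (hS : d.Xf = row4 SX SU SYp SYf * col4 d.Xp d.Up d.Yp d.Yf) (hs : IsSchurStable SX)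
    {lam : ℂ} (hlam : 1 ≤ ‖lam‖) :
    (col4 (lam • toComplex d.Xp - toComplex d.Xf) (toComplex d.Up) (toComplex d.Yp)
      (toComplex d.Yf)).rank = (col3 d.Xp d.Up d.Yf).rank := by
  rw [← rank_col3_toComplex]
  refine rank_eq_of_ker_eq fun c => ?_
  rw [col4_mulVec_eq_zero_iff, col3_mulVec_eq_zero_iff]
  constructor
  · rintro ⟨h₁, hU, hYp, hYf⟩
    refine ⟨?_, hU, hYf⟩
    rw [sub_mulVec, smul_mulVec, sub_eq_zero] at h₁
    by_contra hne
    refine absurd hlam (not_le.2 (hs lam ?_))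
    rw [mem_spectrum_iff_exists_mulVec]
    refine ⟨_, hne, ?_⟩
    rw [h₁]
    simp only [row4, col4, fromCols_mul_fromRows] at hS
    conv_rhs => rw [hS]
    have hadd : ∀ M N : Matrix (Fin n) (Fin T) ℝ, toComplex (M + N) = toComplex M + toComplex N :=
      fun M N => by ext; simp
    simp only [hadd, toComplex_mul, add_mulVec, ← mulVec_mulVec, hU, hYp, hYf, mulVec_zero,
      add_zero]
  · rintro ⟨hX, hU, hYf⟩
    refine ⟨?_, hU, ?_, hYf⟩
    · rw [sub_mulVec, smul_mulVec, hX, ker_le_complex hdata hmatch hX hU hYf]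
      simp
    · rw [Yp_eq hdata, toComplex_mul, ← mulVec_mulVec, hX, mulVec_zero]

/-- One kernel inclusion always holds, so equal ranks make the kernels equal. Writing `w = X_p c`
with `X_f c = λw` puts `c` in the kernel of the four-block matrix, hence `X_p c = 0`. -/
theorem modal_eq_zero_of_rank_eq (D : sys.Decomposition n₁ n₂ s)
    (hdata : d.CollectedFrom sys ηd) (hinf : d.IsInformative ηd D)
    (hmatch : (fromBlocks sys.E sys.F sys.C 0).rank = n + q) {lam : ℂ}
    (hrank : (col4 (lam • toComplex d.Xp - toComplex d.Xf) (toComplex d.Up) (toComplex d.Yp)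
      (toComplex d.Yf)).rank = (col3 d.Xp d.Up d.Yf).rank) {w : Fin n → ℂ} {v : Fin q → ℂ}
    (hE : lam • (toComplex sys.E *ᵥ w) = toComplex sys.A *ᵥ w + toComplex sys.F *ᵥ v)
    (hC : toComplex sys.C *ᵥ w = 0) : w = 0 := by
  obtain ⟨c, hXp, hXf, hUp⟩ := exists_coeff_complex D hdata hinf hE hC
  rw [← rank_col3_toComplex] at hrank
  have := ker_le_of_rank_eq (fun c hc => by
    rw [col3_mulVec_eq_zero_iff] at hc
    obtain ⟨hX, hU, hYf⟩ := hc
    rw [col4_mulVec_eq_zero_iff]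
    refine ⟨?_, hU, ?_, hYf⟩
    · rw [sub_mulVec, smul_mulVec, hX, ker_le_complex hdata hmatch hX hU hYf]
      simp
    · rw [Yp_eq hdata, toComplex_mul, ← mulVec_mulVec, hX, mulVec_zero]) hrank c (by
    rw [col4_mulVec_eq_zero_iff]
    refine ⟨?_, hUp, ?_, ?_⟩
    · rw [sub_mulVec, smul_mulVec, hXp, hXf, sub_self]
    · rw [Yp_eq hdata, toComplex_mul, ← mulVec_mulVec, hXp, hC]
    · rw [Yf_eq hdata, toComplex_mul, ← mulVec_mulVec, hXf, mulVec_smul, hC, smul_zero])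
  rw [col3_mulVec_eq_zero_iff, hXp] at this
  exact this.1

theorem Xf_eq_row4_mul_col4 (hdata : d.CollectedFrom sys ηd)
    {W₁ : Matrix (Fin n) (Fin n) ℝ} {W₂ : Matrix (Fin n) (Fin p) ℝ}
    (h₁ : W₁ * sys.E + W₂ * sys.C = 1) (h₂ : W₁ * sys.F = 0) (G : Matrix (Fin n) (Fin p) ℝ) :
    d.Xf = row4 (W₁ * sys.A - G * sys.C) (W₁ * sys.B) G W₂ * col4 d.Xp d.Up d.Yp d.Yf := by
  have h := congrArg (W₁ * ·) (E_mul_Xf_eq hdata)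
  simp only [Matrix.mul_add, ← Matrix.mul_assoc, h₂, Matrix.zero_mul, add_zero] at h
  rw [row4, col4, fromCols_mul_fromRows, fromCols_mul_fromRows, fromCols_mul_fromRows,
    Yp_eq hdata, Yf_eq hdata]
  calc d.Xf = (W₁ * sys.E + W₂ * sys.C) * d.Xf := by rw [h₁, Matrix.one_mul]
    _ = _ := by
      rw [Matrix.add_mul, h, Matrix.sub_mul, ← Matrix.mul_assoc, ← Matrix.mul_assoc]
      abel

end Data

end Descriptor

theorem mainTheorem3 {n m p q n₁ n₂ s T : ℕ}
    (sys : Descriptor.DescriptorSystem n m p q)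
    (hreg : sys.IsRegular)
    (D : sys.Decomposition n₁ n₂ s)
    (d : Descriptor.Data n m p T s)
    (ηd : Fin (T + s) → Fin q → ℝ)
    (hdata : d.CollectedFrom sys ηd)
    (hinf : d.IsInformative ηd D)
    (hmatch : (Matrix.fromBlocks sys.E sys.F sys.C 0).rank = n + q) :
    LinearMap.ker (Descriptor.col4 d.Xp d.Up d.Yp d.Yf).mulVecLin
        ≤ LinearMap.ker d.Xf.mulVecLin ∧
    List.TFAE [
      ∃ (AO : Matrix (Fin n) (Fin n) ℝ) (BOu : Matrix (Fin n) (Fin m) ℝ)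
        (BOy : Matrix (Fin n) (Fin p) ℝ) (NO : Matrix (Fin n) (Fin p) ℝ),
        sys.IsUnknownInputObserver AO BOu BOy NO,
      ∃ (SX : Matrix (Fin n) (Fin n) ℝ) (SU : Matrix (Fin n) (Fin m) ℝ)
        (SYp : Matrix (Fin n) (Fin p) ℝ) (SYf : Matrix (Fin n) (Fin p) ℝ),
        d.Xf = Descriptor.row4 SX SU SYp SYf * Descriptor.col4 d.Xp d.Up d.Yp d.Yf ∧
        Descriptor.IsSchurStable SX,
      ∀ lam : ℂ, 1 ≤ ‖lam‖ →
        (Descriptor.col4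
          (lam • Descriptor.toComplex d.Xp - Descriptor.toComplex d.Xf)
          (Descriptor.toComplex d.Up) (Descriptor.toComplex d.Yp)
          (Descriptor.toComplex d.Yf)).rank
        = (Descriptor.col3 d.Xp d.Up d.Yf).rank,
      ∀ lam : ℂ, 1 ≤ ‖lam‖ →
        (Matrix.fromBlocks
          (lam • Descriptor.toComplex sys.E - Descriptor.toComplex sys.A)
          (-Descriptor.toComplex sys.F) (Descriptor.toComplex sys.C) 0).rank
        = n + q] := by
  refine ⟨fun c hc => ?_, ?_⟩
  · rw [LinearMap.mem_ker, mulVecLin_apply, Descriptor.Data.col4_mulVec_eq_zero_iff] at hc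
    exact Descriptor.Data.ker_le hdata hmatch hc.1 hc.2.1 hc.2.2.2
  tfae_have 1 → 4 := by
    rintro ⟨AO, BOu, BOy, NO, hO⟩ lam hlam
    exact Descriptor.DescriptorSystem.rank_pencil_eq hmatch fun w v hE hC =>
      Descriptor.DescriptorSystem.eq_zero_of_observer hO hlam hE hC
  tfae_have 4 → 1 := by
    intro h
    obtain ⟨W₁, W₂, G, h₁, h₂, hs⟩ := sys.exists_isSchurStable_of_rank hmatch h
    exact ⟨_, _, _, _, Descriptor.DescriptorSystem.exists_observer h₁ h₂ hs⟩
  tfae_have 4 → 2 := by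
    intro h
    obtain ⟨W₁, W₂, G, h₁, h₂, hs⟩ := sys.exists_isSchurStable_of_rank hmatch h
    exact ⟨_, _, _, _, Descriptor.Data.Xf_eq_row4_mul_col4 hdata h₁ h₂ G, hs⟩
  tfae_have 2 → 3 := by
    rintro ⟨SX, SU, SYp, SYf, hS, hs⟩ lam hlam
    exact Descriptor.Data.rank_eq_of_isSchurStable hdata hmatch hS hs hlam
  tfae_have 3 → 4 := by
    intro h lam hlam
    exact Descriptor.DescriptorSystem.rank_pencil_eq hmatch fun w v hE hC =>
      Descriptor.Data.modal_eq_zero_of_rank_eq D hdata hinf hmatch (h lam hlam) hE hC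
  tfae_finish
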